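/- Let $L\ge 0$ and $M\ge 1$ be integers with $L\neq M$, and let $d_M$ be a real polynomial of degree $M$ with no real roots. For $c=(c_0,\dots,c_L)\in\mathbb{R}^{L+1}$ let $$PT_c(x)=\frac{\sum_{j=0}^{L}c_jx^j}{d_M(x)},\qquad x\in\mathbb{R},$$ be the Padé-type activation function of degree $(L,M)$ with coefficients $c$. For $\rho:\mathbb{R}\to\mathbb{R}$ and $n,m,k\in\mathbb{N}$ let $\mathcal{NN}^{\rho}_{n,m,k}$ be the class of functions $\mathbb{R}^n\to\mathbb{R}^m$ described by fully connected feedforward neural networks with $n$ input neurons, $m$ output neurons with the identity activation, and an arbitrary number (at least one) of hidden layers, each with $k$ neurons with activation function $\rho$ (every layer applies an arbitrary affine map followed by the activation in each coordinate). Let $n,m\in\mathbb{N}$ and let $U\subset\mathbb{R}^n$ be compact. 1. For every $c\in\mathbb{R}^{L+1}$ such that $PT_c$ is not a polynomial function (equivalently, $d_M$ does not divide $\sum_{j=0}^L c_jx^j$), the functions in $\mathcal{NN}^{PT_c}_{n,m,n+m+1}$ are continuous on $U$, and their restrictions to $U$ are dense in $C(U;\mathbb{R}^m)$ with respect to the uniform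 norm. 2. With the coefficients of the activation left free, i.e. for the class $\bigcup_{c\in\mathbb{R}^{L+1}}\mathcal{NN}^{PT_c}_{n,m,n+m+1}$, the same holds without any condition: its members are continuous on $U$, and their restrictions to $U$ are dense in $C(U;\mathbb{R}^m)$ with respect to the uniform norm. -/

import Mathlib

open scoped Matrix Polynomial

/-- The function `x ↦ (∑_{j=0}^L c_j x^j) / d(x)`. It is the Padé-type activation function of
degree `(L, M)` when `d` is a polynomial of degree `M` without real roots. -/
noncomputable def padeType {L : ℕ} (c : Fin (L + 1) → ℝ) (d : ℝ[X]) (x : ℝ) : ℝ :=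
  (∑ j : Fin (L + 1), c j * x ^ (j : ℕ)) / d.eval x

/-- `f : ℝ → ℝ` is a polynomial function. -/
def IsPolynomialFunction (f : ℝ → ℝ) : Prop :=
  ∃ p : ℝ[X], ∀ x : ℝ, f x = p.eval x

/-- One fully connected layer: an affine map followed by `ρ` in every coordinate. -/
def layer (ρ : ℝ → ℝ) {n k : ℕ} (A : Matrix (Fin k) (Fin n) ℝ) (b : Fin k → ℝ)
    (x : Fin n → ℝ) : Fin k → ℝ :=
  fun i => ρ ((A *ᵥ x + b) i)

/-- The maps `ℝⁿ → ℝᵏ` that are computed by a stack of one or more hidden layers, each consisting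
of `k` neurons with activation function `ρ`. -/
inductive IsHiddenStack (ρ : ℝ → ℝ) (n k : ℕ) : ((Fin n → ℝ) → (Fin k → ℝ)) → Prop
  | first (A : Matrix (Fin k) (Fin n) ℝ) (b : Fin k → ℝ) :
      IsHiddenStack ρ n k (layer ρ A b)
  | next (h : (Fin n → ℝ) → (Fin k → ℝ)) (A : Matrix (Fin k) (Fin k) ℝ) (b : Fin k → ℝ) :
      IsHiddenStack ρ n k h → IsHiddenStack ρ n k (fun x => layer ρ A b (h x))

/-- The class of functions `ℝⁿ → ℝᵐ` described by feedforward networks with `n` input neurons,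
`m` output neurons with the identity activation, and an arbitrary (positive) number of hidden
layers, each with `k` neurons with activation function `ρ`. -/
def NN (n m k : ℕ) (ρ : ℝ → ℝ) : Set ((Fin n → ℝ) → (Fin m → ℝ)) :=
  {F | ∃ h : (Fin n → ℝ) → (Fin k → ℝ), IsHiddenStack ρ n k h ∧
    ∃ (A : Matrix (Fin m) (Fin k) ℝ) (b : Fin m → ℝ), F = fun x => A *ᵥ h x + b}

/-- The restrictions to `U` of the functions in `S` belong to `C(U; ℝᵐ)` and form a dense subset
of it. For compact `U` the topology of `C(U, Fin m → ℝ)` is that of the uniform norm (and it does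
not depend on the choice of the norm of `ℝᵐ`). -/
def DenseInC {n m : ℕ} (S : Set ((Fin n → ℝ) → (Fin m → ℝ))) (U : Set (Fin n → ℝ)) : Prop :=
  (∀ F ∈ S, ContinuousOn F U) ∧
    Dense {g : C(U, Fin m → ℝ) | ∃ F ∈ S, ∀ x : U, g x = F x}

/-! The activation enters only through being smooth and not polynomial. Of the `n + m + 1` neurons,
`n` carry the input, `m` accumulate the output and one evaluates `ρ (w ⬝ᵥ x + b)`. Carrying a value
needs the identity, which is the limit of `(ρ (α + η y) - ρ α) / (η ρ' α)` as `η → 0`; so all work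
takes place in the closure of the network class (`update_mem_closure`, `registerState_mem_closure`).

The functions that can be added to the output registers without leaving this closure form a closed
subspace containing every ridge function. By `Submodule.eq_top_of_ridge_mem` it is everything:
differentiating `ρ (s f + b)` in `s` at `0` yields all powers of a linear form `f`, hence `exp f`,
and Stone–Weierstrass applies to the span of these exponentials. -/

theorem Polynomial.exists_derivative_eq (p : ℝ[X]) : ∃ q : ℝ[X], q.derivative = p := by
  induction p using Polynomial.induction_on' with
  | add p q hp hq =>
    obtain ⟨P, rfl⟩ := hp
    obtain ⟨Q, rfl⟩ := hq
    exact ⟨P + Q, Polynomial.derivative_add⟩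
  | monomial k a =>
    refine ⟨Polynomial.monomial (k + 1) (a / (k + 1)), ?_⟩
    rw [Polynomial.derivative_monomial]
    have : (k : ℝ) + 1 ≠ 0 := by positivity
    congr 1
    push_cast
    field_simp

theorem isPolynomialFunction_of_iteratedDeriv_eq_zero {k : ℕ} :
    ∀ {f : ℝ → ℝ}, ContDiff ℝ (⊤ : ℕ∞) f → (∀ x, iteratedDeriv k f x = 0) →
      IsPolynomialFunction f := by
  induction k with
  | zero => exact fun {f} _ h => ⟨0, fun x => by simpa using h x⟩
  | succ k ih =>
    intro f hf h
    have hf' : ContDiff ℝ (⊤ : ℕ∞) (deriv f) := (contDiff_infty_iff_deriv.1 hf).2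
    obtain ⟨p, hp⟩ := ih hf' (fun x => by rw [← iteratedDeriv_succ']; exact h x)
    obtain ⟨q, rfl⟩ := p.exists_derivative_eq
    have hfd : Differentiable ℝ f := (contDiff_infty_iff_deriv.1 hf).1
    have hconst : ∀ x y, (fun t => f t - q.eval t) x = (fun t => f t - q.eval t) y := by
      refine is_const_of_deriv_eq_zero (hfd.sub q.differentiable) fun x => ?_
      rw [deriv_fun_sub (hfd x) (q.differentiable x), hp x, Polynomial.deriv, sub_self]
    refine ⟨q + Polynomial.C (f 0 - q.eval 0), fun x => ?_⟩
    have := hconst x 0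
    simp only [Polynomial.eval_add, Polynomial.eval_C] at this ⊢
    linarith

/-! ### Closed subspaces of continuous functions and density of ridge functions -/

section ClosedSubspace

variable {X : Type*} [TopologicalSpace X] [CompactSpace X]

/-- Evaluation at a point commutes with the integral, so `H` is a primitive of `H'` in the Banach
space itself. This upgrades pointwise differentiability to the uniform norm. -/
theorem ContinuousMap.hasDerivAt_of_pointwise {H H' : ℝ → C(X, ℝ)} (hc : Continuous H')
    (hd : ∀ s x, HasDerivAt (fun t => H t x) (H' s x) s) (s : ℝ) : HasDerivAt H (H' s) s := by
  have hH : H = fun t => H 0 + ∫ u in (0 : ℝ)..t, H' u := by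
    funext t
    ext x
    have hev := (ContinuousMap.evalCLM ℝ x).intervalIntegral_comp_comm
      (hc.intervalIntegrable (μ := MeasureTheory.volume) 0 t)
    have hftc := intervalIntegral.integral_eq_sub_of_hasDerivAt (a := 0) (b := t)
      (fun u _ => hd u x) (((continuous_eval_const x).comp hc).intervalIntegrable 0 t)
    simp only [ContinuousMap.evalCLM_apply] at hev
    rw [ContinuousMap.add_apply, ← hev, hftc]
    ring
  rw [hH]
  exact (intervalIntegral.integral_hasDerivAt_right (hc.intervalIntegrable 0 s)
    hc.stronglyMeasurable.stronglyMeasurableAtFilter hc.continuousAt).const_add (H 0)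

theorem Submodule.mem_of_hasDerivAt {E : Type*} [NormedAddCommGroup E] [NormedSpace ℝ E]
    {V : Submodule ℝ E} (hV : IsClosed (V : Set E)) {H : ℝ → E} {H' : E} {s : ℝ}
    (hH : ∀ t, H t ∈ V) (hd : HasDerivAt H H' s) : H' ∈ V :=
  hV.mem_of_tendsto hd.tendsto_slope <| Filter.Eventually.of_forall fun t => by
    rw [slope_def_module]
    exact V.smul_mem _ (V.sub_mem (hH t) (hH s))

theorem ContinuousMap.pow_mul_iteratedDeriv_mem {V : Submodule ℝ C(X, ℝ)}
    (hV : IsClosed (V : Set C(X, ℝ))) {ρ : ℝ → ℝ} (hρ : ContDiff ℝ (⊤ : ℕ∞) ρ) (f : C(X, ℝ))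
    (b : ℝ) (hmem : ∀ (s : ℝ) (g : C(X, ℝ)), (∀ x, g x = ρ (s * f x + b)) → g ∈ V) (k : ℕ) :
    ∀ (s : ℝ) (g : C(X, ℝ)), (∀ x, g x = f x ^ k * iteratedDeriv k ρ (s * f x + b)) → g ∈ V := by
  have hcont : ∀ k, Continuous (iteratedDeriv k ρ) := fun k =>
    hρ.continuous_iteratedDeriv k (by exact_mod_cast le_top)
  induction k with
  | zero => simpa using hmem
  | succ k ih =>
    let G : ℕ → C(ℝ × X, ℝ) := fun j =>
      ⟨fun p => f p.2 ^ j * iteratedDeriv j ρ (p.1 * f p.2 + b), by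
        have := hcont j
        fun_prop⟩
    intro s g hg
    have hd : HasDerivAt (G k).curry ((G (k + 1)).curry s) s := by
      refine ContinuousMap.hasDerivAt_of_pointwise (H' := (G (k + 1)).curry)
        (G (k + 1)).curry.continuous (fun t x => ?_) s
      have h1 : HasDerivAt (iteratedDeriv k ρ) (iteratedDeriv (k + 1) ρ (t * f x + b))
          (t * f x + b) := by
        rw [iteratedDeriv_succ]
        exact (hρ.differentiable_iteratedDeriv k (by exact_mod_cast WithTop.coe_lt_top k)
          _).hasDerivAt
      have h2 : HasDerivAt (fun t => t * f x + b) (f x) t := by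
        simpa using ((hasDerivAt_id t).mul_const (f x)).add_const b
      have h3 := (h1.comp t h2).const_mul (f x ^ k)
      refine h3.congr_deriv ?_
      simp only [G, ContinuousMap.curry_apply, ContinuousMap.coe_mk]
      ring
    have : g = (G (k + 1)).curry s := by
      ext x
      simp [G, hg]
    rw [this]
    exact Submodule.mem_of_hasDerivAt hV (fun t => ih t _ fun x => rfl) hd

theorem ContinuousMap.exp_mem_of_comp_mem {V : Submodule ℝ C(X, ℝ)}
    (hV : IsClosed (V : Set C(X, ℝ))) {ρ : ℝ → ℝ} (hρ : ContDiff ℝ (⊤ : ℕ∞) ρ)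
    (hpoly : ¬ IsPolynomialFunction ρ) (f : C(X, ℝ))
    (hmem : ∀ (s b : ℝ) (g : C(X, ℝ)), (∀ x, g x = ρ (s * f x + b)) → g ∈ V) :
    NormedSpace.exp f ∈ V := by
  have hpow : ∀ k : ℕ, f ^ k ∈ V := by
    intro k
    obtain ⟨b, hb⟩ : ∃ b, iteratedDeriv k ρ b ≠ 0 := by
      by_contra! h
      exact hpoly (isPolynomialFunction_of_iteratedDeriv_eq_zero hρ h)
    -- At `s = 0` the factor `ρ⁽ᵏ⁾ (s f + b)` is a nonzero constant.
    have h := ContinuousMap.pow_mul_iteratedDeriv_mem hV hρ f b (fun s => hmem s b) k 0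
      (iteratedDeriv k ρ b • f ^ k) (fun x => by simp [mul_comm])
    simpa [smul_smul, hb] using V.smul_mem (iteratedDeriv k ρ b)⁻¹ h
  refine hV.mem_of_tendsto (NormedSpace.exp_series_hasSum_exp' (𝕂 := ℝ) f) <|
    Filter.Eventually.of_forall fun s => V.sum_mem fun k _ => V.smul_mem _ (hpow k)

end ClosedSubspace

/-- Universal approximation by ridge functions of a smooth activation that is not a polynomial. -/
theorem Submodule.eq_top_of_ridge_mem {n : ℕ} {U : Set (Fin n → ℝ)} [CompactSpace U]
    {V : Submodule ℝ C(U, ℝ)} (hV : IsClosed (V : Set C(U, ℝ))) {ρ : ℝ → ℝ}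
    (hρ : ContDiff ℝ (⊤ : ℕ∞) ρ) (hpoly : ¬ IsPolynomialFunction ρ)
    (hmem : ∀ (w : Fin n → ℝ) (b : ℝ) (g : C(U, ℝ)),
      (∀ x : U, g x = ρ (w ⬝ᵥ (x : Fin n → ℝ) + b)) → g ∈ V) : V = ⊤ := by
  let f : (Fin n → ℝ) → C(U, ℝ) := fun w => ⟨fun x => w ⬝ᵥ (x : Fin n → ℝ), by
    unfold dotProduct
    exact continuous_finsetSum _ fun i _ =>
      continuous_const.mul ((continuous_apply i).comp continuous_subtype_val)⟩
  have hadd : ∀ w v, f w + f v = f (w + v) := fun w v => by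
    ext x
    simp [f, add_dotProduct]
  -- `V` is only a subspace; since the exponentials are closed under products, the algebra they
  -- generate is their linear span and lies in `V`.
  let T : Submonoid C(U, ℝ) :=
    { carrier := Set.range fun w => NormedSpace.exp (f w)
      one_mem' := ⟨0, by
        have : f 0 = 0 := by
          ext x
          simp [f]
        simp [this]⟩
      mul_mem' := by
        rintro _ _ ⟨w, rfl⟩ ⟨v, rfl⟩
        exact ⟨w + v, by simp only [← hadd, NormedSpace.exp_add]⟩ }
  have hTV : ∀ g ∈ T, g ∈ V := by
    rintro _ ⟨w, rfl⟩
    refine ContinuousMap.exp_mem_of_comp_mem hV hρ hpoly (f w) fun s b g hg =>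
      hmem (s • w) b g fun x => ?_
    rw [hg x, smul_dotProduct]
    rfl
  let A : Subalgebra ℝ C(U, ℝ) := Algebra.adjoin ℝ (T : Set C(U, ℝ))
  have hAV : ∀ g ∈ A, g ∈ V := by
    intro g hg
    have hg' : g ∈ Subalgebra.toSubmodule A := hg
    rw [Algebra.adjoin_eq_span, Submonoid.closure_eq] at hg'
    exact Submodule.span_le.2 hTV hg'
  have hsep : A.SeparatesPoints := by
    intro x y hxy
    obtain ⟨i, hi⟩ : ∃ i, (x : Fin n → ℝ) i ≠ (y : Fin n → ℝ) i := by
      by_contra! h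
      exact hxy (Subtype.ext (funext h))
    refine ⟨_, ⟨NormedSpace.exp (f (Pi.single i 1)), Algebra.subset_adjoin ⟨_, rfl⟩, rfl⟩, ?_⟩
    have hexp : ∀ z : U, NormedSpace.exp (f (Pi.single i 1)) z = Real.exp (z.1 i) := fun z => by
      have := NormedSpace.map_exp (ContinuousMap.evalAlgHom ℝ ℝ z)
        (continuous_eval_const z) (f (Pi.single i 1))
      rw [Real.exp_eq_exp_ℝ]
      simpa [f] using this
    simpa [hexp] using hi
  have htop := ContinuousMap.subalgebra_topologicalClosure_eq_top_of_separatesPoints A hsep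
  refine eq_top_iff.2 fun g _ => ?_
  have hg : g ∈ A.topologicalClosure := htop ▸ Algebra.mem_top
  exact closure_minimal (s := (A : Set C(U, ℝ))) hAV hV hg

/-! ### Continuity of networks and approximate identity neurons -/

theorem IsHiddenStack.continuous {ρ : ℝ → ℝ} (hρ : Continuous ρ) {n k : ℕ}
    {h : (Fin n → ℝ) → (Fin k → ℝ)} (hh : IsHiddenStack ρ n k h) : Continuous h := by
  have hlayer : ∀ {l : ℕ} (A : Matrix (Fin k) (Fin l) ℝ) (b : Fin k → ℝ),
      Continuous (layer ρ A b) := fun A b => continuous_pi fun i =>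
    hρ.comp ((continuous_apply i).comp
      ((continuous_const.matrix_mulVec continuous_id).add continuous_const))
  induction hh with
  | first A b => exact hlayer A b
  | next h A b _ ih => exact (hlayer A b).comp ih

theorem NN.continuous {ρ : ℝ → ℝ} (hρ : Continuous ρ) {n m k : ℕ}
    {F : (Fin n → ℝ) → (Fin m → ℝ)} (hF : F ∈ NN n m k ρ) : Continuous F := by
  obtain ⟨h, hh, A, b, rfl⟩ := hF
  exact (continuous_const.matrix_mulVec (hh.continuous hρ)).add continuous_const

/-- The neuron `y ↦ (ρ (α + η * y) - ρ α) / (η * ρ' α)`, extended by the identity at `η = 0`. -/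
noncomputable def identityNeuron (ρ : ℝ → ℝ) (α η y : ℝ) : ℝ :=
  dslope ρ α (α + η * y) * y / deriv ρ α

theorem identityNeuron_zero {ρ : ℝ → ℝ} {α : ℝ} (hα : deriv ρ α ≠ 0) (y : ℝ) :
    identityNeuron ρ α 0 y = y := by
  simp [identityNeuron, hα]

theorem identityNeuron_of_ne_zero {ρ : ℝ → ℝ} {α η : ℝ} (hη : η ≠ 0) (y : ℝ) :
    identityNeuron ρ α η y =
      (η * deriv ρ α)⁻¹ * ρ (η * y + α) + -((η * deriv ρ α)⁻¹ * ρ α) := by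
  have h := sub_smul_dslope ρ α (α + η * y)
  rw [add_sub_cancel_left, smul_eq_mul] at h
  have h' : dslope ρ α (α + η * y) * y = η⁻¹ * (ρ (α + η * y) - ρ α) := by
    rw [← h]
    field_simp
  rw [identityNeuron, h', add_comm (η * y) α, mul_inv]
  ring

/-- Joint continuity is what matters: after currying it gives convergence in `C(U, _)` as `η → 0`.
-/
theorem continuous_identityNeuron {ρ : ℝ → ℝ} (hρ : Differentiable ℝ ρ) (α : ℝ) :
    Continuous fun p : ℝ × ℝ => identityNeuron ρ α p.1 p.2 := by
  have hd : Continuous (dslope ρ α) := by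
    rw [← continuousOn_univ, continuousOn_dslope Filter.univ_mem]
    exact ⟨hρ.continuous.continuousOn, hρ α⟩
  unfold identityNeuron
  fun_prop

open Classical in
/-- The coordinates in `s` go through `ρ`, the others through the identity neuron. -/
noncomputable def mixedActivation (ρ : ℝ → ℝ) (α : ℝ) {k : ℕ} (s : Set (Fin k)) (η : ℝ)
    (y : Fin k → ℝ) : Fin k → ℝ :=
  fun i => if i ∈ s then ρ (y i) else identityNeuron ρ α η (y i)

theorem continuous_mixedActivation {ρ : ℝ → ℝ} (hρ : Differentiable ℝ ρ) (α : ℝ) {k : ℕ}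
    (s : Set (Fin k)) :
    Continuous fun p : ℝ × (Fin k → ℝ) => mixedActivation ρ α s p.1 p.2 := by
  refine continuous_pi fun i => ?_
  unfold mixedActivation
  split_ifs
  · exact hρ.continuous.comp ((continuous_apply i).comp continuous_snd)
  · exact (continuous_identityNeuron hρ α).comp
      (continuous_fst.prodMk ((continuous_apply i).comp continuous_snd))

theorem exists_mixedActivation_eq_layer (ρ : ℝ → ℝ) (α : ℝ) {k l : ℕ} (s : Set (Fin k)) {η : ℝ}
    (hη : η ≠ 0) (A : Matrix (Fin k) (Fin l) ℝ) (b : Fin k → ℝ) :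
    ∃ (A' : Matrix (Fin k) (Fin l) ℝ) (b' : Fin k → ℝ) (D : Matrix (Fin k) (Fin k) ℝ)
      (d : Fin k → ℝ), ∀ z, mixedActivation ρ α s η (A *ᵥ z + b) = D *ᵥ layer ρ A' b' z + d := by
  classical
  -- The scaling by `η` and the shift by `α` go into the affine map before `ρ`; their inverse
  -- normalization goes into `D` and `d` after it.
  let E : Matrix (Fin k) (Fin k) ℝ := Matrix.diagonal fun i => if i ∈ s then 1 else η
  refine ⟨E * A, E *ᵥ b + fun i => if i ∈ s then 0 else α,
    Matrix.diagonal fun i => if i ∈ s then 1 else (η * deriv ρ α)⁻¹,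
    fun i => if i ∈ s then 0 else -((η * deriv ρ α)⁻¹ * ρ α), fun z => funext fun i => ?_⟩
  have hE : (E * A) *ᵥ z + (E *ᵥ b + fun i => if i ∈ s then 0 else α) =
      E *ᵥ (A *ᵥ z + b) + fun i => if i ∈ s then 0 else α := by
    rw [Matrix.mulVec_add, Matrix.mulVec_mulVec, add_assoc]
  rw [Pi.add_apply, Matrix.mulVec_diagonal, layer, hE, Pi.add_apply, Matrix.mulVec_diagonal,
    mixedActivation]
  split_ifs
  · simp
  · exact identityNeuron_of_ne_zero hη _

theorem Continuous.apply_zero_mem_of_isClosed {E : Type*} [TopologicalSpace E] {C : Set E}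
    (hC : IsClosed C) {H : ℝ → E} (hH : Continuous H) (hmem : ∀ η ≠ 0, H η ∈ C) : H 0 ∈ C :=
  hC.mem_of_tendsto ((hH.tendsto 0).mono_left (nhdsWithin_le_nhds (s := {0}ᶜ)))
    (eventually_nhdsWithin_of_forall hmem)

/-! ### Operations preserving the closure of the network class -/

section Closure

variable {n k : ℕ} {ρ : ℝ → ℝ} {U : Set (Fin n → ℝ)}

/-- The restrictions to `U` of the functions of `NN n p k ρ`. -/
def restrictedNN (ρ : ℝ → ℝ) (k p : ℕ) (U : Set (Fin n → ℝ)) : Set C(U, Fin p → ℝ) :=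
  {g | ∃ F ∈ NN n p k ρ, ∀ x : U, g x = F x}

theorem affine_comp_mem_closure {p q : ℕ} {g : C(U, Fin p → ℝ)}
    (hg : g ∈ closure (restrictedNN ρ k p U)) (B : (Fin p → ℝ) →ₗ[ℝ] (Fin q → ℝ))
    (c : Fin q → ℝ) (g' : C(U, Fin q → ℝ)) (hg' : ∀ x, g' x = B (g x) + c) :
    g' ∈ closure (restrictedNN ρ k q U) := by
  let T : C(Fin p → ℝ, Fin q → ℝ) :=
    ⟨fun y => B y + c, B.continuous_of_finiteDimensional.add continuous_const⟩
  have : g' = T.comp g := by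
    ext1 x
    exact hg' x
  rw [this]
  refine map_mem_closure (ContinuousMap.continuous_postcomp T) hg ?_
  rintro f ⟨_, ⟨h, hh, A, b, rfl⟩, hf⟩
  refine ⟨_, ⟨h, hh, B.toMatrix' * A, B b + c, rfl⟩, fun x => ?_⟩
  change B (f x) + c = _
  rw [hf x, map_add, ← Matrix.mulVec_mulVec, LinearMap.toMatrix'_mulVec, add_assoc]

theorem affine_mem_closure (hρ : Differentiable ℝ ρ) {α : ℝ} (hα : deriv ρ α ≠ 0)
    (B : (Fin n → ℝ) →ₗ[ℝ] (Fin k → ℝ)) (g : C(U, Fin k → ℝ)) (hg : ∀ x : U, g x = B x) :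
    g ∈ closure (restrictedNN ρ k k U) := by
  let G : C(ℝ × U, Fin k → ℝ) := ⟨fun p => mixedActivation ρ α ∅ p.1 (g p.2),
    (continuous_mixedActivation hρ α ∅).comp
      (continuous_fst.prodMk (g.continuous.comp continuous_snd))⟩
  have h0 : g = G.curry 0 := by
    ext x i
    simp [G, mixedActivation, identityNeuron_zero hα]
  rw [h0]
  refine Continuous.apply_zero_mem_of_isClosed isClosed_closure G.curry.continuous
    fun η hη => subset_closure ?_
  obtain ⟨A', b', D, d, h⟩ := exists_mixedActivation_eq_layer ρ α ∅ hη B.toMatrix' 0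
  refine ⟨_, ⟨_, .first A' b', D, d, rfl⟩, fun x => ?_⟩
  rw [← h, LinearMap.toMatrix'_mulVec, add_zero, ← hg]
  rfl

/-- For an actual network, one more hidden layer with approximate identities outside `j` tends to
the update as `η → 0`; its output map is absorbed into the new layer. Continuity of postcomposition
extends this to the closure. -/
theorem update_mem_closure (hρ : Differentiable ℝ ρ) {α : ℝ} (hα : deriv ρ α ≠ 0)
    {g : C(U, Fin k → ℝ)} (hg : g ∈ closure (restrictedNN ρ k k U)) (j : Fin k)
    (g' : C(U, Fin k → ℝ)) (hg' : ∀ x, g' x = Function.update (g x) j (ρ (g x j))) :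
    g' ∈ closure (restrictedNN ρ k k U) := by
  have hcont := continuous_mixedActivation hρ α {j}
  let T : C(Fin k → ℝ, Fin k → ℝ) :=
    ⟨mixedActivation ρ α {j} 0, hcont.comp (continuous_const.prodMk continuous_id)⟩
  have hT : g' = T.comp g := by
    ext x i
    by_cases hi : i = j
    · subst hi
      simp [T, hg', mixedActivation]
    · simp [T, hg', mixedActivation, identityNeuron_zero hα, hi]
  rw [hT, ← closure_closure (s := restrictedNN ρ k k U)]
  refine map_mem_closure (ContinuousMap.continuous_postcomp T) hg ?_
  rintro f ⟨_, ⟨h, hh, A, b, rfl⟩, hf⟩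
  let G : C(ℝ × U, Fin k → ℝ) := ⟨fun p => mixedActivation ρ α {j} p.1 (f p.2),
    hcont.comp (continuous_fst.prodMk (f.continuous.comp continuous_snd))⟩
  refine Continuous.apply_zero_mem_of_isClosed (H := G.curry) isClosed_closure G.curry.continuous
    fun η hη => subset_closure ?_
  obtain ⟨A', b', D, d, h'⟩ := exists_mixedActivation_eq_layer ρ α {j} hη A b
  refine ⟨_, ⟨_, .next h A' b' hh, D, d, rfl⟩, fun x => ?_⟩
  have hx : f x = A *ᵥ h x + b := hf x
  rw [← h', ← hx]
  rfl

end Closure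

/-! ### The register model of width `n + m + 1` -/

section Registers

variable {n m : ℕ}

/-- The neurons of a layer: registers for the input, registers for the output, and one neuron
that computes. -/
def registerEquiv (n m : ℕ) : (Fin n ⊕ Fin m) ⊕ Fin 1 ≃ Fin (n + m + 1) :=
  (Equiv.sumCongr finSumFinEquiv (Equiv.refl _)).trans finSumFinEquiv

/-- The position of the computing neuron. -/
def computingNeuron (n m : ℕ) : Fin (n + m + 1) := registerEquiv n m (Sum.inr 0)

def inputRegisters (n m : ℕ) : (Fin (n + m + 1) → ℝ) →ₗ[ℝ] (Fin n → ℝ) :=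
  LinearMap.funLeft ℝ ℝ fun i => registerEquiv n m (Sum.inl (Sum.inl i))

def outputRegisters (n m : ℕ) : (Fin (n + m + 1) → ℝ) →ₗ[ℝ] (Fin m → ℝ) :=
  LinearMap.funLeft ℝ ℝ fun i => registerEquiv n m (Sum.inl (Sum.inr i))

/-- The layer with given input registers, output registers and value of the computing neuron. -/
def registerState (n m : ℕ) :
    (Fin n → ℝ) × (Fin m → ℝ) × ℝ →ₗ[ℝ] (Fin (n + m + 1) → ℝ) where
  toFun p i := Sum.elim (Sum.elim p.1 p.2.1) (fun _ => p.2.2) ((registerEquiv n m).symm i)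
  map_add' p q := by
    ext i
    obtain ⟨i, rfl⟩ := (registerEquiv n m).surjective i
    rcases i with (i | i) | i <;> simp
  map_smul' r p := by
    ext i
    obtain ⟨i, rfl⟩ := (registerEquiv n m).surjective i
    rcases i with (i | i) | i <;> simp

theorem inputRegisters_registerState (p : (Fin n → ℝ) × (Fin m → ℝ) × ℝ) :
    inputRegisters n m (registerState n m p) = p.1 := by
  ext i
  simp [inputRegisters, registerState, LinearMap.funLeft_apply]

theorem outputRegisters_registerState (p : (Fin n → ℝ) × (Fin m → ℝ) × ℝ) :
    outputRegisters n m (registerState n m p) = p.2.1 := by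
  ext i
  simp [outputRegisters, registerState, LinearMap.funLeft_apply]

theorem registerState_computingNeuron (p : (Fin n → ℝ) × (Fin m → ℝ) × ℝ) :
    registerState n m p (computingNeuron n m) = p.2.2 := by
  simp [registerState, computingNeuron]

theorem update_registerState (x : Fin n → ℝ) (y : Fin m → ℝ) (t s : ℝ) :
    Function.update (registerState n m (x, y, t)) (computingNeuron n m) s =
      registerState n m (x, y, s) := by
  ext i
  obtain ⟨i, rfl⟩ := (registerEquiv n m).surjective i
  rcases i with (i | i) | i
  · simp [registerState, computingNeuron]
  · simp [registerState, computingNeuron]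
  · obtain rfl : i = 0 := Subsingleton.elim _ _
    simp [registerState, computingNeuron]

/-- One cycle of the machine: load `w ⬝ᵥ x + b` into the free neuron, activate it, then add `a`
times its value to the output and clear it. -/
theorem registerState_mem_closure {ρ : ℝ → ℝ} (hρ : Differentiable ℝ ρ) {α : ℝ}
    (hα : deriv ρ α ≠ 0) {U : Set (Fin n → ℝ)} {y : C(U, Fin m → ℝ)}
    {g : C(U, Fin (n + m + 1) → ℝ)} (hg : g ∈ closure (restrictedNN ρ (n + m + 1) _ U))
    (hy : ∀ x : U, g x = registerState n m (x, y x, 0)) (w : Fin n → ℝ) (b : ℝ) (a : Fin m → ℝ)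
    {g' : C(U, Fin (n + m + 1) → ℝ)}
    (hy' : ∀ x : U, g' x = registerState n m (x, y x + ρ (w ⬝ᵥ (x : Fin n → ℝ) + b) • a, 0)) :
    g' ∈ closure (restrictedNN ρ (n + m + 1) _ U) := by
  have hst : Continuous (registerState n m) :=
    (registerState n m).continuous_of_finiteDimensional
  have hw : Continuous fun x : U => w ⬝ᵥ (x : Fin n → ℝ) + b :=
    (continuous_const.dotProduct continuous_subtype_val).add continuous_const
  let g₁ : C(U, Fin (n + m + 1) → ℝ) :=
    ⟨fun x => registerState n m (x, y x, w ⬝ᵥ (x : Fin n → ℝ) + b),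
      hst.comp (continuous_subtype_val.prodMk (y.continuous.prodMk hw))⟩
  let g₂ : C(U, Fin (n + m + 1) → ℝ) :=
    ⟨fun x => registerState n m (x, y x, ρ (w ⬝ᵥ (x : Fin n → ℝ) + b)),
      hst.comp (continuous_subtype_val.prodMk
        (y.continuous.prodMk (hρ.continuous.comp hw)))⟩
  have h₁ : g₁ ∈ closure (restrictedNN ρ (n + m + 1) _ U) := by
    refine affine_comp_mem_closure hg (registerState n m ∘ₗ (inputRegisters n m).prod
      ((outputRegisters n m).prod (dotProductBilin ℝ ℝ w ∘ₗ inputRegisters n m)))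
      (registerState n m (0, 0, b)) g₁ fun x => ?_
    simp [g₁, hy, inputRegisters_registerState, outputRegisters_registerState, ← map_add]
  have h₂ : g₂ ∈ closure (restrictedNN ρ (n + m + 1) _ U) :=
    update_mem_closure hρ hα h₁ (computingNeuron n m) g₂ fun x => by
      simp [g₁, g₂, registerState_computingNeuron, update_registerState]
  refine affine_comp_mem_closure h₂ (registerState n m ∘ₗ (inputRegisters n m).prod
    ((outputRegisters n m + (LinearMap.proj (computingNeuron n m)).smulRight a).prod 0))
    0 g' fun x => ?_
  simp [hy', g₂, inputRegisters_registerState, outputRegisters_registerState,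
    registerState_computingNeuron]

theorem dense_restrictedNN {ρ : ℝ → ℝ} (hρ : ContDiff ℝ (⊤ : ℕ∞) ρ)
    (hpoly : ¬ IsPolynomialFunction ρ) {U : Set (Fin n → ℝ)} (hU : IsCompact U) :
    Dense (restrictedNN ρ (n + m + 1) m U) := by
  have : CompactSpace U := isCompact_iff_compactSpace.1 hU
  have hd : Differentiable ℝ ρ := (contDiff_infty_iff_deriv.1 hρ).1
  obtain ⟨α, hα⟩ : ∃ α, deriv ρ α ≠ 0 := by
    by_contra! h
    exact hpoly (isPolynomialFunction_of_iteratedDeriv_eq_zero (k := 1) hρ (by simpa using h))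
  have hst : Continuous (registerState n m) :=
    (registerState n m).continuous_of_finiteDimensional
  let X₀ : C(U, Fin (n + m + 1) → ℝ) := ⟨fun x => registerState n m (x, 0, 0),
    hst.comp (continuous_subtype_val.prodMk continuous_const)⟩
  let E : C(Fin m → ℝ, Fin (n + m + 1) → ℝ) := ⟨fun y => registerState n m (0, y, 0),
    hst.comp (continuous_const.prodMk (continuous_id.prodMk continuous_const))⟩
  let lift : C(U, Fin m → ℝ) → C(U, Fin (n + m + 1) → ℝ) := fun y => X₀ + E.comp y
  have hlift : ∀ y (x : U), lift y x = registerState n m (x, y x, 0) := fun y x => by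
    simp [lift, X₀, E, ← map_add]
  have hliftc : Continuous lift := continuous_const.add (ContinuousMap.continuous_postcomp E)
  let out : (Fin m → ℝ) → C(U, ℝ) → C(U, Fin m → ℝ) := fun a v =>
    (⟨fun t => t • a, by fun_prop⟩ : C(ℝ, Fin m → ℝ)).comp v
  have hout : ∀ a v x, out a v x = v x • a := fun _ _ _ => rfl
  have houtc : ∀ a, Continuous (out a) := fun a => ContinuousMap.continuous_postcomp _
  let G := closure (restrictedNN ρ (n + m + 1) (n + m + 1) U)
  -- Quantifying over every reachable `y` makes sums a matter of two successive additions;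
  -- quantifying over `a` absorbs scalars.
  let V : Submodule ℝ C(U, ℝ) :=
    { carrier := {v | ∀ y, lift y ∈ G → ∀ a, lift (y + out a v) ∈ G}
      add_mem' := fun {u v} hu hv y hy a => by
        have : y + out a (u + v) = y + out a u + out a v := by
          ext x i
          simp [hout, add_mul, add_assoc]
        rw [this]
        exact hv _ (hu y hy a) a
      zero_mem' := fun y hy a => by
        have : y + out a 0 = y := by
          ext x i
          simp [hout]
        rwa [this]
      smul_mem' := fun r v hv y hy a => by
        have : out a (r • v) = out (r • a) v := by
          ext x i
          simp only [hout, ContinuousMap.smul_apply, smul_eq_mul, Pi.smul_apply]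
          ring
        rw [this]
        exact hv y hy _ }
  have hVc : IsClosed (V : Set C(U, ℝ)) := by
    change IsClosed {v | ∀ y, lift y ∈ G → ∀ a, lift (y + out a v) ∈ G}
    simp only [Set.ofPred_forall]
    exact isClosed_iInter fun y => isClosed_iInter fun _ => isClosed_iInter fun a =>
      isClosed_closure.preimage (hliftc.comp (continuous_const.add (houtc a)))
  have hV : V = ⊤ := by
    refine Submodule.eq_top_of_ridge_mem hVc hρ hpoly fun w b g hg y hy a => ?_
    refine registerState_mem_closure hd hα hy (hlift y) w b a fun x => ?_
    rw [hlift, ContinuousMap.add_apply, hout, hg]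
  -- The target is written into the output registers one coordinate at a time, starting from the
  -- state `(x, 0, 0)`, which is linear in `x`.
  have hsum : ∀ (g : C(U, Fin m → ℝ)) (s : Finset (Fin m)),
      lift (∑ i ∈ s, out (Pi.single i 1) ((ContinuousMap.mk fun y : Fin m → ℝ => y i).comp g))
        ∈ G := by
    intro g s
    induction s using Finset.induction_on with
    | empty =>
      refine affine_mem_closure hd hα (registerState n m ∘ₗ LinearMap.inl ℝ _ _) _ fun x => ?_
      rw [hlift]
      rfl
    | insert i s hi ih =>
      rw [Finset.sum_insert hi, add_comm (out _ _)]
      exact (hV ▸ Submodule.mem_top : _ ∈ V) _ ih _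
  intro g
  refine affine_comp_mem_closure (hsum g Finset.univ) (outputRegisters n m) 0 g fun x => ?_
  rw [hlift, outputRegisters_registerState, add_zero]
  ext j
  simp [hout, ContinuousMap.sum_apply, Finset.sum_apply, Pi.single_apply]

end Registers

/-! ### Padé-type activations -/

theorem contDiff_padeType {L : ℕ} (c : Fin (L + 1) → ℝ) {d : ℝ[X]}
    (hroot : ∀ x : ℝ, d.eval x ≠ 0) : ContDiff ℝ (⊤ : ℕ∞) (padeType c d) := by
  unfold padeType
  exact (ContDiff.sum fun j _ => contDiff_const.mul (contDiff_id.pow _)).div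
    (by simpa using d.contDiff_aeval (𝕜 := ℝ) (⊤ : ℕ∞)) hroot

/-- The function is `1 / d`; if it were a polynomial, `d` would be a unit and so of degree zero. -/
theorem not_isPolynomialFunction_padeType_single {L : ℕ} {d : ℝ[X]} (hdeg : 0 < d.natDegree)
    (hroot : ∀ x : ℝ, d.eval x ≠ 0) :
    ¬ IsPolynomialFunction (padeType (Pi.single (0 : Fin (L + 1)) (1 : ℝ)) d) := by
  rintro ⟨p, hp⟩
  have h1 : p * d = 1 := Polynomial.funext fun x => by
    have := hp x
    simp only [padeType, Pi.single_apply, ite_mul, one_mul, zero_mul, Finset.sum_ite_eq',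
      Finset.mem_univ, if_true, Fin.val_zero, pow_zero] at this
    rw [Polynomial.eval_mul, Polynomial.eval_one, ← this, one_div_mul_cancel (hroot x)]
  exact hdeg.ne' (Polynomial.natDegree_eq_zero_of_isUnit (IsUnit.of_mul_eq_one_right p h1))

theorem theorem1 (L M : ℕ) (hM : 0 < M) (hLM : L ≠ M)
    (d : ℝ[X]) (hdeg : d.natDegree = M) (hroot : ∀ x : ℝ, d.eval x ≠ 0)
    (n m : ℕ) (U : Set (Fin n → ℝ)) (hU : IsCompact U) :
    (∀ c : Fin (L + 1) → ℝ, ¬ IsPolynomialFunction (padeType c d) →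
        DenseInC (NN n m (n + m + 1) (padeType c d)) U) ∧
      DenseInC (⋃ c : Fin (L + 1) → ℝ, NN n m (n + m + 1) (padeType c d)) U := by
  refine ⟨fun c hc => ⟨fun F hF => ?_, dense_restrictedNN (contDiff_padeType c hroot) hc hU⟩,
    fun F hF => ?_, ?_⟩
  · exact (NN.continuous (contDiff_padeType c hroot).continuous hF).continuousOn
  · obtain ⟨c, hF⟩ := Set.mem_iUnion.1 hF
    exact (NN.continuous (contDiff_padeType c hroot).continuous hF).continuousOn
  -- The single activation `1 / d` already gives a dense subset of the union.
  · refine (dense_restrictedNN (contDiff_padeType (Pi.single 0 1) hroot)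
      (not_isPolynomialFunction_padeType_single (L := L) (hdeg ▸ hM) hroot) hU).mono ?_
    rintro g ⟨F, hF, hg⟩
    exact ⟨F, Set.mem_iUnion.2 ⟨_, hF⟩, hg⟩
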